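/- All graphs are finite undirected multigraphs: parallel edges are allowed, self-loops are not. For such a graph $G$ with vertex set $V$, write $\operatorname{Div}^0(G)$ for the group of functions $D:V\to\mathbb Z$ with $\sum_{v\in V}D(v)=0$, and $\operatorname{Prin}(G)$ for the subgroup of all functions of the form $v\mapsto\sum_{e=\{v,w\}\in E(G)}(f(v)-f(w))$ with $f:V\to\mathbb Z$ (edges are counted with multiplicity). The Jacobian of $G$ is $\operatorname{Jac}G=\operatorname{Div}^0(G)/\operatorname{Prin}(G)$, and its exponent is the smallest positive integer $m$ with $ma=0$ for all $a\in\operatorname{Jac}G$. The graph $G$ is biconnected if it is connected and remains connected after the removal of any one vertex (the graph with one vertex and the graph with two vertices and one edge count as biconnected). For $k=2$ and for $k=3$ there are, up to isomorphism, only finitely many biconnected graphs $G$ such that the exponent of $\operatorname{Jac}G$ is at most $k$. Moreover, up to isomorphism: 1. the only biconnected graph $G$ for which $\operatorname{Jac}G$ has exponent exactly $2$ is the $2$-cycle $C_2$ (two vertices joined by two parallel edges); 2. the biconnected graphs $G$ for which $\operatorname{Jac}G$ has exponent exactly $3$ are exactly the banana graph with three edges (two vertices joined by three parallel edges) and the $3$-cycle.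 -/

import Mathlib

open scoped Graph

namespace Graph

universe u v u' v'

variable {α : Type u} {β : Type v} {α' : Type u'} {β' : Type v'}

/-- Two multigraphs are isomorphic if there are a bijection of their vertex sets and a bijection of
their edge sets that are compatible with incidence. -/
def IsIsomorphic (G : Graph α β) (H : Graph α' β') : Prop :=
  ∃ (φ : V(G) ≃ V(H)) (ψ : E(G) ≃ E(H)), ∀ (e : E(G)) (x y : V(G)),
    G.IsLink e x y ↔ H.IsLink (ψ e) (φ x) (φ y)

/-- A multigraph is biconnected if it is (nonempty and) connected and it stays connected after the
removal of any one vertex. The graph without vertices, which is what remains of a one-vertex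
graph, is regarded as connected here; so the graphs with one vertex, and with two vertices and
one edge, are biconnected. -/
def IsBiconnected (G : Graph α β) : Prop :=
  G.toSimpleGraph.Connected ∧ ∀ v ∈ V(G), (G.deleteVerts {v}).toSimpleGraph.Preconnected

/-- The number of edges with ends `x` and `y`. -/
noncomputable def edgeMult (G : Graph α β) (x y : α) : ℕ :=
  {e | G.IsLink e x y}.ncard

/-- The subgroup `Div⁰(G)` of divisors of degree `0` on `G`, in the group `V(G) → ℤ` of all
divisors. -/
def divZero (G : Graph α β) [Fintype V(G)] : AddSubgroup (V(G) → ℤ) where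
  carrier := {D | ∑ v, D v = 0}
  zero_mem' := by simp
  add_mem' := by
    intro a b ha hb
    simp only [Set.mem_ofPred_eq] at ha hb ⊢
    simp [Finset.sum_add_distrib, ha, hb]
  neg_mem' := by
    intro a ha
    simp only [Set.mem_ofPred_eq] at ha ⊢
    simp [ha]

/-- The principal divisor of `f`: its value at `v` is the sum of `f v - f w` over the edges
between `v` and a vertex `w`, each edge being counted separately. -/
noncomputable def divOf (G : Graph α β) [Fintype V(G)] : (V(G) → ℤ) →+ (V(G) → ℤ) where
  toFun f := fun v => ∑ w : V(G), (G.edgeMult v w : ℤ) * (f v - f w)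
  map_zero' := by
    funext v
    simp
  map_add' := by
    intro f g
    funext v
    simp only [Pi.add_apply, ← Finset.sum_add_distrib]
    exact Finset.sum_congr rfl fun w _ => by ring

/-- The subgroup `Prin(G)` of principal divisors. -/
noncomputable def prin (G : Graph α β) [Fintype V(G)] : AddSubgroup (V(G) → ℤ) :=
  (divOf G).range

/-- Principal divisors have degree `0`. -/
theorem prin_le_divZero (G : Graph α β) [Fintype V(G)] : prin G ≤ divZero G := by
  rintro _ ⟨f, rfl⟩
  change ∑ v : V(G), ∑ w : V(G), (G.edgeMult v w : ℤ) * (f v - f w) = 0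
  have hsymm : ∀ v w : V(G), G.edgeMult v w = G.edgeMult w v := by
    intro v w
    simp only [edgeMult, G.isLink_comm]
  have h : ∑ v : V(G), ∑ w : V(G), (G.edgeMult v w : ℤ) * (f v - f w)
      = - ∑ v : V(G), ∑ w : V(G), (G.edgeMult v w : ℤ) * (f v - f w) := by
    conv_lhs => rw [Finset.sum_comm]
    simp only [← Finset.sum_neg_distrib]
    refine Finset.sum_congr rfl fun v _ => Finset.sum_congr rfl fun w _ => ?_
    rw [hsymm w v]
    ring
  omega

/-- The Jacobian `Jac(G) = Div⁰(G) / Prin(G)`, for a multigraph with finitely many vertices and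
edges. -/
abbrev Jac (G : Graph α β) [Fintype V(G)] : Type u :=
  divZero G ⧸ (prin G).addSubgroupOf (divZero G)

/-- The `n`-cycle: its vertices and its edges are the elements of `Fin n`, and the edge `i` links
the vertices `i` and `i + 1` (modulo `n`). For `n = 2` these are two parallel edges. -/
def cycle (n : ℕ) [NeZero n] : Graph (Fin n) (Fin n) where
  vertexSet := Set.univ
  IsLink e x y := (x = e ∧ y = e + 1) ∨ (x = e + 1 ∧ y = e)
  isLink_symm := by
    intro e _
    exact ⟨fun x y h => by tauto⟩
  eq_or_eq_of_isLink_of_isLink := by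
    intro e x y v w h h'
    rcases h with ⟨rfl, rfl⟩ | ⟨rfl, rfl⟩ <;> rcases h' with ⟨rfl, rfl⟩ | ⟨rfl, rfl⟩ <;> simp
  left_mem_of_isLink := by simp

/-- The banana graph: two vertices joined by `n` parallel edges. -/
def bananaGraph (n : ℕ) : Graph (Fin 2) (Fin n) :=
  Graph.banana 0 1 Set.univ

end Graph

/-! ### Laplacians of nonnegative symmetric integer matrices -/

section WeightedLaplacian

variable {V : Type*} [Fintype V]

/-! Let $k\le 3$ be positive and kill the Jacobian, and let $u,v$ be adjacent. Then
$k(\delta_u-\delta_v)$ is the Laplacian of some integer function $f$. By biconnectedness, the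
maximum principle makes $u$ the only maximum of $f$ and $v$ the only minimum
(`LaplacianKilledBy.exists_potential`). So $k=\sum_w a(u,w)(f(u)-f(w))$ has nonnegative terms,
positive at each neighbour of $u$.

If there is a third vertex, then $f(u)-f(v)\ge 2$, and $u$ has a second neighbour, since otherwise
$v$ would be a cut vertex. Hence $k\ge 2+1$. Equality forces simple edges at $u$, degree two and a
triangle on $uv$ (`LaplacianKilledBy.neighbours`); by connectedness the triangle is the whole graph.
On two vertices, $m$ parallel edges satisfy $m\le k$, while $m$ kills the Jacobian.

The exponent is positive because $L+J$ is nonsingular, $J$ being the all-ones matrix. Conversely,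
the model graphs have exponent dividing a prime, and the case $k=1$ excludes exponent 1. -/

/-- The Laplacian of the symmetric matrix of edge multiplicities `a`. -/
def weightedLaplacian (a : V → V → ℤ) (f : V → ℤ) (v : V) : ℤ :=
  ∑ w, a v w * (f v - f w)

/-- A predicate that holds somewhere and is preserved along the support of `a` holds everywhere. -/
def SupportConnected (a : V → V → ℤ) : Prop :=
  ∀ P : V → Prop, (∃ x, P x) → (∀ x y, a x y ≠ 0 → P x → P y) → ∀ y, P y

/-- The support of `a` is connected away from any one point. -/
def SupportBiconnected (a : V → V → ℤ) : Prop :=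
  ∀ (u : V) (P : V → Prop), (∃ x, x ≠ u ∧ P x) →
    (∀ x y, x ≠ u → y ≠ u → a x y ≠ 0 → P x → P y) → ∀ y, y ≠ u → P y

theorem weightedLaplacian_neg (a : V → V → ℤ) (f : V → ℤ) (v : V) :
    weightedLaplacian a (-f) v = -weightedLaplacian a f v := by
  simp only [weightedLaplacian, Pi.neg_apply, ← Finset.sum_neg_distrib]
  exact Finset.sum_congr rfl fun w _ => by ring

theorem sum_weightedLaplacian {a : V → V → ℤ} (hs : ∀ x y, a x y = a y x) (f : V → ℤ) :
    ∑ v, weightedLaplacian a f v = 0 := by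
  have h : ∑ v, weightedLaplacian a f v = -∑ v, weightedLaplacian a f v := by
    conv_lhs => simp only [weightedLaplacian]; rw [Finset.sum_comm]
    simp only [weightedLaplacian, ← Finset.sum_neg_distrib]
    refine Finset.sum_congr rfl fun v _ => Finset.sum_congr rfl fun w _ => ?_
    rw [hs w v]
    ring
  omega

/-! ### Maximum principle -/

/-- Where a maximum has nonpositive Laplacian, all neighbours are maxima too. -/
theorem eq_of_weightedLaplacian_nonpos {a : V → V → ℤ} (ha : ∀ x y, 0 ≤ a x y) {f : V → ℤ} {x : V}
    (hmax : ∀ y, f y ≤ f x) (hx : weightedLaplacian a f x ≤ 0) {y : V} (hxy : a x y ≠ 0) :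
    f y = f x := by
  have hnn : ∀ w ∈ Finset.univ, 0 ≤ a x w * (f x - f w) := fun w _ =>
    mul_nonneg (ha x w) (sub_nonneg.2 (hmax w))
  have h0 := (Finset.sum_eq_zero_iff_of_nonneg hnn).1 (le_antisymm hx (Finset.sum_nonneg hnn)) y
    (Finset.mem_univ y)
  have := (mul_eq_zero.1 h0).resolve_left hxy
  omega

theorem eq_of_weightedLaplacian_eq_zero {a : V → V → ℤ} (ha : ∀ x y, 0 ≤ a x y)
    (hc : SupportConnected a) {f : V → ℤ} (hf : ∀ x, weightedLaplacian a f x = 0) (x y : V) :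
    f x = f y := by
  have : Nonempty V := ⟨x⟩
  obtain ⟨m, hm⟩ := Finite.exists_max f
  have key : ∀ z, f z = f m := by
    refine hc (fun z => f z = f m) ⟨m, rfl⟩ fun z w hzw hz => ?_
    rw [eq_of_weightedLaplacian_nonpos ha (fun y => hz ▸ hm y) (hf z).le hzw, hz]
  rw [key x, key y]

/-- The maximum principle on a biconnected support. -/
theorem lt_of_weightedLaplacian_nonpos {a : V → V → ℤ} (ha : ∀ x y, 0 ≤ a x y)
    (hb : SupportBiconnected a) {f : V → ℤ} {u : V} (hu : 0 < weightedLaplacian a f u)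
    (hf : ∀ x, x ≠ u → weightedLaplacian a f x ≤ 0) {x : V} (hx : x ≠ u) : f x < f u := by
  have : Nonempty V := ⟨x⟩
  obtain ⟨m, hm⟩ := Finite.exists_max f
  by_contra hlt
  have hex : ∃ z, z ≠ u ∧ f z = f m := by
    by_cases hmu : m = u
    · exact ⟨x, hx, le_antisymm (hm x) (hmu ▸ not_lt.1 hlt)⟩
    · exact ⟨m, hmu, rfl⟩
  -- A maximum attained off `u` spreads over everything except `u`, so no difference `f u - f w` is
  -- positive, against `hu`.
  have key := hb u (fun z => f z = f m) hex fun z w hz _ hzw hzm => by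
    rw [eq_of_weightedLaplacian_nonpos ha (fun y => hzm ▸ hm y) (hf z hz) hzw, hzm]
  refine hu.not_ge (Finset.sum_nonpos fun w _ => ?_)
  rcases eq_or_ne w u with rfl | hw
  · simp
  · exact mul_nonpos_of_nonneg_of_nonpos (ha u w) (by rw [key w hw]; linarith [hm u])

/-! ### Classification when a small `k` kills the cokernel -/

/-- `k` annihilates the cokernel of the Laplacian in degree zero. -/
def LaplacianKilledBy (a : V → V → ℤ) (k : ℤ) : Prop :=
  ∀ D : V → ℤ, ∑ v, D v = 0 → ∃ f : V → ℤ, ∀ v, weightedLaplacian a f v = k * D v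

/-- Take a preimage of $k(\delta_u-\delta_v)$ and apply the maximum principle to `f` at `u` and to
`-f` at `v`. -/
theorem LaplacianKilledBy.exists_potential {a : V → V → ℤ} (ha : ∀ x y, 0 ≤ a x y)
    (hb : SupportBiconnected a) {k : ℤ} (hk0 : 0 < k) (hk : LaplacianKilledBy a k) {u v : V}
    (huv : u ≠ v) :
    ∃ f : V → ℤ, weightedLaplacian a f u = k ∧ weightedLaplacian a f v = -k ∧
      (∀ x, x ≠ u → x ≠ v → weightedLaplacian a f x = 0) ∧
      (∀ x, x ≠ u → f x < f u) ∧ ∀ x, x ≠ v → f v < f x := by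
  classical
  obtain ⟨f, hf⟩ := hk (fun x => (if x = u then 1 else 0) - if x = v then 1 else 0) (by simp)
  have h1 : weightedLaplacian a f u = k := by simp [hf, huv]
  have h2 : weightedLaplacian a f v = -k := by simp [hf, huv.symm]
  have h3 : ∀ x, x ≠ u → x ≠ v → weightedLaplacian a f x = 0 := fun x hx hx' => by
    simp [hf, hx, hx']
  refine ⟨f, h1, h2, h3, fun x hx => ?_, fun x hx => ?_⟩
  · refine lt_of_weightedLaplacian_nonpos ha hb (by omega) (fun y hy => ?_) hx
    rcases eq_or_ne y v with rfl | hyv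
    · omega
    · exact (h3 y hy hyv).le
  · have := lt_of_weightedLaplacian_nonpos (f := -f) (u := v) (x := x) ha hb
      (by rw [weightedLaplacian_neg]; omega) (fun y hy => ?_) hx
    · simpa using this
    · rw [weightedLaplacian_neg]
      rcases eq_or_ne y u with rfl | hyu
      · omega
      · exact (neg_eq_zero.2 (h3 y hyu hy)).le

theorem LaplacianKilledBy.le_of_ne {a : V → V → ℤ} (ha : ∀ x y, 0 ≤ a x y)
    (hb : SupportBiconnected a) {k : ℤ} (hk0 : 0 < k) (hk : LaplacianKilledBy a k) {u v : V}
    (huv : u ≠ v) : a u v ≤ k := by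
  obtain ⟨f, h1, -, -, h4, -⟩ := hk.exists_potential ha hb hk0 huv
  have hnn : ∀ w ∈ Finset.univ, 0 ≤ a u w * (f u - f w) := fun w _ => by
    rcases eq_or_ne w u with rfl | hw
    · simp
    · exact mul_nonneg (ha u w) (sub_nonneg.2 (h4 w hw).le)
  have := Finset.single_le_sum hnn (Finset.mem_univ v)
  rw [← weightedLaplacian, h1] at this
  nlinarith [ha u v, h4 v huv.symm]

/-- With a third vertex `t`, the terms of the Laplacian at `u` already add up to at least 3, so
every estimate is an equality. -/
theorem LaplacianKilledBy.neighbours {a : V → V → ℤ} (ha : ∀ x y, 0 ≤ a x y)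
    (hs : ∀ x y, a x y = a y x) (hb : SupportBiconnected a) {k : ℤ} (hk0 : 0 < k) (hk3 : k ≤ 3)
    (hk : LaplacianKilledBy a k) {u v t : V} (huv : u ≠ v) (htu : t ≠ u) (htv : t ≠ v)
    (hadj : a u v ≠ 0) :
    k = 3 ∧ a u v = 1 ∧ ∃ w, w ≠ u ∧ w ≠ v ∧ a u w = 1 ∧ a w v ≠ 0 ∧
      ∀ x, x ≠ u → x ≠ v → x ≠ w → a u x = 0 := by
  classical
  obtain ⟨f, h1, h2, h3, h4, h5⟩ := hk.exists_potential ha hb hk0 huv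
  have hnn : ∀ w, 0 ≤ a u w * (f u - f w) := fun w => by
    rcases eq_or_ne w u with rfl | hw
    · simp
    · exact mul_nonneg (ha u w) (sub_nonneg.2 (h4 w hw).le)
  -- Otherwise deleting `v` would separate `u` from `t`.
  obtain ⟨w, hwu, hwv, hw⟩ : ∃ w, w ≠ u ∧ w ≠ v ∧ a u w ≠ 0 := by
    by_contra! hno
    refine htu (hb v (fun x => x = u) ⟨u, huv, rfl⟩ (fun x y _ hy hxy hx => ?_) t htv)
    subst hx
    by_contra hyx
    exact hxy (hno y hyx hy)
  have hle : ∀ s : Finset V, ∑ x ∈ s, a u x * (f u - f x) ≤ k := fun s =>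
    h1 ▸ Finset.sum_le_sum_of_subset_of_nonneg (Finset.subset_univ s) fun x _ _ => hnn x
  have hpair := hle {v, w}
  rw [Finset.sum_pair hwv.symm] at hpair
  have e1 := h4 t htu
  have e2 := h5 t htv
  have e3 := h4 w hwu
  have p1 : 1 ≤ a u v := by have := ha u v; omega
  have p2 : 1 ≤ a u w := by have := ha u w; omega
  -- The value `f t` lies strictly between `f v` and `f u`.
  have q1 : 2 ≤ f u - f v := by omega
  have q2 : 1 ≤ f u - f w := by omega
  -- This is $(p-1)(q-1)\ge 0$ for the two factors $p,q\ge 1$.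
  have m1 : a u v + (f u - f v) - 1 ≤ a u v * (f u - f v) := by nlinarith
  have m1' : 2 * a u v ≤ a u v * (f u - f v) := by nlinarith
  have m2 : a u w + (f u - f w) - 1 ≤ a u w * (f u - f w) := by nlinarith
  have huv1 : a u v = 1 := by omega
  have huw1 : a u w = 1 := by omega
  have fuv : f u - f v = 2 := by omega
  have fuw : f u - f w = 1 := by omega
  have hmid : ∀ x, x ≠ u → x ≠ v → f u - f x = 1 := fun x hx hx' => by
    have := h4 x hx
    have := h5 x hx'
    omega
  refine ⟨by omega, huv1, w, hwu, hwv, huw1, fun hwv0 => ?_, fun x hxu hxv hxw => ?_⟩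
  · have hz := h3 w hwu hwv
    have : weightedLaplacian a f w = ∑ x ∈ {u, v}, a w x * (f w - f x) := by
      refine (Finset.sum_subset (Finset.subset_univ _) fun x _ hx => ?_).symm
      simp only [Finset.mem_insert, Finset.mem_singleton, not_or] at hx
      have := hmid x hx.1 hx.2
      rw [show f w - f x = 0 by omega, mul_zero]
    rw [this, Finset.sum_pair huv, hwv0, hs w u, huw1] at hz
    omega
  -- The neighbours `v` and `w` use up the whole budget $2+1=3$.
  · have htrip := hle {v, w, x}
    rw [Finset.sum_insert (by simp [hwv.symm, hxv.symm]), Finset.sum_pair hxw.symm,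
      hmid x hxu hxv, huv1, huw1] at htrip
    have := ha u x
    omega

/-- The matrix of the complete graph on `n` vertices whose edges all have multiplicity `m`. -/
def IsUniformMatrix (a : V → V → ℤ) (n : ℕ) (m : ℤ) : Prop :=
  Fintype.card V = n ∧ ∀ x y, x ≠ y → a x y = m

/-- Applying `neighbours` at each corner of the triangle shows that no edge leaves it. The
multiplicity 0 in the one-vertex case is a placeholder. -/
theorem LaplacianKilledBy.classification {a : V → V → ℤ} (ha : ∀ x y, 0 ≤ a x y)
    (hs : ∀ x y, a x y = a y x) (hc : SupportConnected a)
    (hb : SupportBiconnected a) {k : ℤ} (hk0 : 0 < k) (hk3 : k ≤ 3) (hk : LaplacianKilledBy a k)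
    [Nonempty V] :
    IsUniformMatrix a 1 0 ∨ (∃ m, 0 < m ∧ m ≤ k ∧ IsUniformMatrix a 2 m) ∨
      (k = 3 ∧ IsUniformMatrix a 3 1) := by
  classical
  obtain ⟨u⟩ := ‹Nonempty V›
  by_cases hex : ∃ v, v ≠ u ∧ a u v ≠ 0
  · obtain ⟨v, hvu, hadj⟩ := hex
    right
    by_cases ht : ∃ t, t ≠ u ∧ t ≠ v
    · right
      obtain ⟨t, htu, htv⟩ := ht
      have hadj' : a v u ≠ 0 := hs u v ▸ hadj
      obtain ⟨rfl, huv, w, hwu, hwv, huw, hwv0, hun⟩ :=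
        hk.neighbours ha hs hb hk0 hk3 hvu.symm htu htv hadj
      have huw0 : a u w ≠ 0 := by omega
      have hvw0 : a v w ≠ 0 := hs w v ▸ hwv0
      have hwu0 : a w u ≠ 0 := hs u w ▸ huw0
      obtain ⟨-, hvw, w', hwv', hww', -, -, hvn⟩ :=
        hk.neighbours ha hs hb hk0 hk3 hwv.symm hvu.symm hwu.symm hvw0
      obtain ⟨-, -, z, hzw, hzu, -, -, hwn⟩ :=
        hk.neighbours ha hs hb hk0 hk3 hwu hwv.symm hvu hwu0
      have hw' : w' = u := by
        by_contra h
        exact hadj' (hvn u hvu.symm hwu.symm (Ne.symm h))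
      have hz : z = v := by
        by_contra h
        exact hwv0 (hwn v hwv.symm hvu (Ne.symm h))
      subst hw' hz
      have hall : ∀ x, x = w' ∨ x = z ∨ x = w := by
        refine hc _ ⟨w', Or.inl rfl⟩ fun x y hxy hx => ?_
        by_contra! hy
        rcases hx with rfl | rfl | rfl
        · exact hxy (hun y hy.1 hy.2.1 hy.2.2)
        · exact hxy (hvn y hy.2.1 hy.2.2 hy.1)
        · exact hxy (hwn y hy.2.2 hy.1 hy.2.1)
      refine ⟨rfl, ?_, fun x y hxy => ?_⟩
      · rw [← Finset.card_univ,
          show (Finset.univ : Finset V) = {w', z, w} by ext x; simpa using hall x]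
        exact Finset.card_eq_three.2 ⟨w', z, w, hvu.symm, hwu.symm, hwv.symm, rfl⟩
      · have := hs w' z
        have := hs w' w
        have := hs z w
        rcases hall x with rfl | rfl | rfl <;> rcases hall y with rfl | rfl | rfl <;>
          first | omega | simp at hxy
    · left
      push Not at ht
      have hall : ∀ x, x = u ∨ x = v := fun x => or_iff_not_imp_left.2 (ht x)
      refine ⟨a u v, lt_of_le_of_ne (ha u v) hadj.symm, hk.le_of_ne ha hb hk0 hvu.symm, ?_, ?_⟩
      · rw [← Finset.card_univ, show (Finset.univ : Finset V) = {u, v} by ext x; simpa using hall x]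
        exact Finset.card_pair hvu.symm
      · intro x y hxy
        rcases hall x with rfl | rfl <;> rcases hall y with rfl | rfl
        · simp at hxy
        · rfl
        · exact hs _ _
        · simp at hxy
  · left
    push Not at hex
    have hall : ∀ x, x = u := hc _ ⟨u, rfl⟩ fun x y hxy hx => by
      subst hx
      by_contra h
      exact hxy (hex y h)
    exact ⟨Fintype.card_eq_one_iff.2 ⟨u, hall⟩, fun x y hxy => by simp [hall x, hall y] at hxy⟩

/-! ### Finiteness of the cokernel -/

/-- The degree-zero cokernel of the Laplacian of a connected support is finite. -/
theorem exists_laplacianKilledBy {a : V → V → ℤ} (ha : ∀ x y, 0 ≤ a x y)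
    (hs : ∀ x y, a x y = a y x) (hc : SupportConnected a) [Nonempty V] :
    ∃ k : ℕ, 0 < k ∧ LaplacianKilledBy a k := by
  classical
  -- This is $L+J$. A kernel vector has sum zero, hence is killed by $L$, hence is constant, hence
  -- vanishes.
  let M : Matrix V V ℤ := Matrix.of fun v w => (if v = w then ∑ x, a v x else 0) - a v w + 1
  have hM : ∀ f v, M.mulVec f v = weightedLaplacian a f v + ∑ w, f w := fun f v => by
    simp only [M, Matrix.mulVec, dotProduct, Matrix.of_apply, add_mul, sub_mul, ite_mul, zero_mul,
      one_mul, Finset.sum_add_distrib, Finset.sum_sub_distrib, Finset.sum_ite_eq, Finset.mem_univ,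
      if_true, weightedLaplacian, mul_sub, Finset.sum_mul]
  have hsum : ∀ f, ∑ v, M.mulVec f v = Fintype.card V * ∑ w, f w := fun f => by
    simp [hM, Finset.sum_add_distrib, sum_weightedLaplacian hs]
  have hcard : (Fintype.card V : ℤ) ≠ 0 := by exact_mod_cast Fintype.card_ne_zero
  have hdet : M.det ≠ 0 := fun h0 => by
    obtain ⟨f, hf0, hf⟩ := Matrix.exists_mulVec_eq_zero_iff.2 h0
    have hsf : ∑ w, f w = 0 := by
      have := hsum f
      simp only [hf, Pi.zero_apply, Finset.sum_const_zero] at this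
      exact (mul_eq_zero.1 this.symm).resolve_left hcard
    have hL : ∀ v, weightedLaplacian a f v = 0 := fun v => by
      have := hM f v
      rw [hf, hsf] at this
      simpa using this.symm
    refine hf0 (funext fun v => ?_)
    have hcst := eq_of_weightedLaplacian_eq_zero ha hc hL
    rw [Finset.sum_congr rfl fun w _ => hcst w v] at hsf
    simpa using hsf
  refine ⟨M.det.natAbs, Int.natAbs_pos.2 hdet, fun D hD => ?_⟩
  have key : ∀ v, M.mulVec (M.adjugate.mulVec D) v = M.det * D v := fun v => by
    rw [Matrix.mulVec_mulVec, Matrix.mul_adjugate, Matrix.smul_mulVec, Matrix.one_mulVec]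
    simp
  -- The adjugate vector has sum zero, so $J$ kills it and $L$ alone sends it to $\det(M)\,D$.
  have h0 : ∑ w, M.adjugate.mulVec D w = 0 := by
    have := hsum (M.adjugate.mulVec D)
    simp only [key, ← Finset.mul_sum, hD, mul_zero] at this
    exact (mul_eq_zero.1 this.symm).resolve_left hcard
  have hL : ∀ v, weightedLaplacian a (M.adjugate.mulVec D) v = M.det * D v := fun v => by
    rw [← key, hM, h0, add_zero]
  rcases Int.natAbs_eq M.det with h | h
  · exact ⟨_, fun v => by rw [hL, ← h]⟩
  · refine ⟨-M.adjugate.mulVec D, fun v => ?_⟩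
    rw [weightedLaplacian_neg, hL]
    nth_rewrite 1 [h]
    ring

/-- On functions of sum zero the Laplacian is multiplication by $mn$. -/
theorem IsUniformMatrix.killedBy {a : V → V → ℤ} {n : ℕ} {m : ℤ} (h : IsUniformMatrix a n m) :
    LaplacianKilledBy a (m * n) := fun D hD => by
  have ha : ∀ f : V → ℤ, ∀ v, weightedLaplacian a f v = m * (n * f v - ∑ w, f w) := fun f v => by
    have : ∀ w, a v w * (f v - f w) = m * (f v - f w) := fun w => by
      rcases eq_or_ne v w with rfl | hvw
      · simp
      · rw [h.2 v w hvw]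
    simp [weightedLaplacian, this, ← Finset.mul_sum, h.1]
  exact ⟨D, fun v => by rw [ha, hD]; ring⟩

/-- Sharper than $2m$: $D=(d,-d)$ satisfies $mD=L(d,0)$. -/
theorem IsUniformMatrix.killedBy_two {a : V → V → ℤ} {m : ℤ} (h : IsUniformMatrix a 2 m) :
    LaplacianKilledBy a m := fun D hD => by
  classical
  obtain ⟨x, y, hxy, hu⟩ := Finset.card_eq_two.1 (Finset.card_univ.trans h.1)
  have hall : ∀ v, v = x ∨ v = y := fun v => by simpa [hu] using Finset.mem_univ v
  rw [hu, Finset.sum_pair hxy] at hD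
  refine ⟨fun v => if v = x then D x else 0, fun v => ?_⟩
  rw [weightedLaplacian, hu, Finset.sum_pair hxy]
  rcases hall v with rfl | rfl
  · simp [h.2 _ _ hxy, hxy.symm]
  · simp only [h.2 _ _ hxy.symm, hxy.symm, if_true, if_false]
    rw [show D v = -D x by omega]
    ring

end WeightedLaplacian

/-! ### From graphs to multiplicity matrices -/

namespace Graph

universe u v u' v'

variable {α : Type u} {β : Type v} {α' : Type u'} {β' : Type v'}

/-- The matrix of edge multiplicities. -/
noncomputable def multMatrix (G : Graph α β) (x y : V(G)) : ℤ :=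
  G.edgeMult x y

theorem edgeMult_comm (G : Graph α β) (x y : α) : G.edgeMult x y = G.edgeMult y x := by
  simp only [edgeMult, G.isLink_comm]

theorem multMatrix_nonneg (G : Graph α β) (x y : V(G)) : 0 ≤ G.multMatrix x y :=
  Int.natCast_nonneg _

theorem multMatrix_comm (G : Graph α β) (x y : V(G)) : G.multMatrix x y = G.multMatrix y x := by
  rw [multMatrix, edgeMult_comm, multMatrix]

theorem divOf_apply (G : Graph α β) [Fintype V(G)] (f : V(G) → ℤ) (v : V(G)) :
    divOf G f v = weightedLaplacian G.multMatrix f v := rfl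

theorem exponent_jac_dvd_iff (G : Graph α β) [Fintype V(G)] (k : ℕ) :
    AddMonoid.exponent G.Jac ∣ k ↔ LaplacianKilledBy G.multMatrix k := by
  rw [AddMonoid.exponent_dvd_iff_forall_nsmul_eq_zero]
  have key : ∀ D : divZero G, k • (QuotientAddGroup.mk D : G.Jac) = 0 ↔
      ∃ f : V(G) → ℤ, ∀ v, weightedLaplacian G.multMatrix f v = k * D.1 v := fun D => by
    rw [← QuotientAddGroup.mk_nsmul, QuotientAddGroup.eq_zero_iff, AddSubgroup.mem_addSubgroupOf]
    refine exists_congr fun f => ?_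
    rw [funext_iff]
    refine forall_congr' fun v => ?_
    rw [divOf_apply]
    simp
  constructor
  · intro h D hD
    exact (key ⟨D, hD⟩).1 (h _)
  · intro h g
    obtain ⟨D, rfl⟩ := QuotientAddGroup.mk_surjective g
    exact (key D).2 (h D.1 D.2)

/-- Finiteness of the edge set matters, as `Set.ncard` is 0 on infinite sets. -/
theorem edgeMult_ne_zero_iff (G : Graph α β) [Finite E(G)] {x y : α} :
    G.edgeMult x y ≠ 0 ↔ G.Adj x y := by
  have hfin : {e | G.IsLink e x y}.Finite :=
    (Set.toFinite E(G)).subset fun e he => IsLink.edge_mem he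
  rw [edgeMult, ← Nat.pos_iff_ne_zero, Set.ncard_pos hfin]
  rfl

theorem multMatrix_ne_zero_iff (G : Graph α β) [Finite E(G)] {x y : V(G)} :
    G.multMatrix x y ≠ 0 ↔ G.Adj x y := by
  rw [← edgeMult_ne_zero_iff, multMatrix, Nat.cast_ne_zero]

theorem _root_.SimpleGraph.Reachable.induct {V : Type*} {S : SimpleGraph V} {x y : V}
    (h : S.Reachable x y) {P : V → Prop} (hP : ∀ x y, S.Adj x y → P x → P y) (hx : P x) : P y := by
  obtain ⟨p⟩ := h
  induction p with
  | nil => exact hx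
  | cons hadj _ ih => exact ih (hP _ _ hadj hx)

theorem supportConnected_multMatrix {G : Graph α β} [Finite E(G)]
    (h : G.toSimpleGraph.Preconnected) : SupportConnected G.multMatrix := by
  rintro P ⟨x, hx⟩ hP y
  exact (h x y).induct (fun z w hzw => hP z w (G.multMatrix_ne_zero_iff.2 hzw.2)) hx

theorem supportBiconnected_multMatrix {G : Graph α β} [Finite E(G)]
    (h : ∀ v ∈ V(G), (G.deleteVerts {v}).toSimpleGraph.Preconnected) :
    SupportBiconnected G.multMatrix := by
  rintro u P ⟨x, hxu, hx⟩ hP y hyu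
  have hmem : ∀ z : V(G), z ≠ u → z.1 ∈ V(G.deleteVerts {u.1}) := fun z hz => by
    simpa using fun h => hz (Subtype.ext h)
  have hsub : ∀ z ∈ V(G.deleteVerts {u.1}), z ∈ V(G) ∧ z ≠ u.1 := fun z hz => by simpa using hz
  refine ((h u u.2 ⟨x, hmem x hxu⟩ ⟨y, hmem y hyu⟩).induct
    (P := fun z => P ⟨z.1, (hsub z z.2).1⟩) (fun z w hzw => ?_) hx :)
  refine hP _ _ (fun h => (hsub z z.2).2 (congrArg Subtype.val h))
    (fun h => (hsub w w.2).2 (congrArg Subtype.val h)) (G.multMatrix_ne_zero_iff.2 ?_)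
  obtain ⟨-, e, he⟩ := hzw
  exact ⟨e, ((deleteVerts_isLink ..).1 he).1⟩

/-! ### Uniform graphs, isomorphisms and models -/

/-- A graph with `n` vertices, any two distinct ones being joined by `m` edges, without loops. -/
def IsUniform (G : Graph α β) (n m : ℕ) : Prop :=
  Nat.card V(G) = n ∧ ∀ x ∈ V(G), ∀ y ∈ V(G), (x = y → G.edgeMult x y = 0) ∧
    (x ≠ y → G.edgeMult x y = m)

theorem isUniform_of_isUniformMatrix {G : Graph α β} [Fintype V(G)] [Finite E(G)]
    (hl : G.Loopless) {n m : ℕ} (h : IsUniformMatrix G.multMatrix n m) : G.IsUniform n m := by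
  refine ⟨by rw [Nat.card_eq_fintype_card, h.1], fun x hx y hy => ⟨?_, fun hxy => ?_⟩⟩
  · rintro rfl
    by_contra h0
    exact G.not_adj_self x (G.edgeMult_ne_zero_iff.1 h0)
  · have := h.2 ⟨x, hx⟩ ⟨y, hy⟩ fun h => hxy (congrArg Subtype.val h)
    rw [multMatrix] at this
    exact_mod_cast this

namespace IsUniform

variable {G : Graph α β} {n m : ℕ}

theorem isUniformMatrix [Fintype V(G)] (h : G.IsUniform n m) :
    IsUniformMatrix G.multMatrix n m := by
  refine ⟨by rw [← Nat.card_eq_fintype_card, h.1], fun x y hxy => ?_⟩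
  rw [multMatrix, (h.2 x x.2 y y.2).2 fun h => hxy (Subtype.ext h)]

theorem loopless [Finite E(G)] (h : G.IsUniform n m) : G.Loopless := by
  rw [loopless_iff_forall_ne_of_adj]
  intro x y hxy hne
  exact G.edgeMult_ne_zero_iff.2 hxy ((h.2 x hxy.left_mem y hxy.symm.left_mem).1 hne)

theorem isBiconnected [Finite E(G)] (h : G.IsUniform n m) (hn : n ≠ 0) (hm : m ≠ 0) :
    G.IsBiconnected := by
  have hadj : ∀ x ∈ V(G), ∀ y ∈ V(G), x ≠ y → G.Adj x y := fun x hx y hy hxy => by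
    rw [← edgeMult_ne_zero_iff, (h.2 x hx y hy).2 hxy]
    exact hm
  have : Nonempty V(G) := by
    have h0 := h.1 ▸ hn
    exact (Nat.card_ne_zero.1 h0).1
  refine ⟨⟨fun x y => ?_⟩, fun v _ x y => ?_⟩
  · by_cases hxy : x = y
    · rw [hxy]
    · exact SimpleGraph.Adj.reachable
        ⟨hxy, hadj x x.2 y y.2 fun h => hxy (Subtype.ext h)⟩
  · by_cases hxy : x = y
    · rw [hxy]
    · have hsub : ∀ z ∈ V(G.deleteVerts {v}), z ∈ V(G) ∧ z ≠ v := fun z hz => by simpa using hz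
      obtain ⟨e, he⟩ := hadj x (hsub x x.2).1 y (hsub y y.2).1 fun h => hxy (Subtype.ext h)
      exact SimpleGraph.Adj.reachable
        ⟨hxy, e, (deleteVerts_isLink ..).2 ⟨he, (hsub x x.2).2, (hsub y y.2).2⟩⟩

end IsUniform

theorem edgeMult_eq_card (G : Graph α β) (x y : α) :
    G.edgeMult x y = Nat.card {e : E(G) // G.IsLink e x y} :=
  (Nat.card_congr (Equiv.subtypeSubtypeEquivSubtype fun h => IsLink.edge_mem h)).symm

/-- Incidence becomes a map to unordered pairs, so that edge bijections can be built fibre by fibre.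
-/
theorem exists_ends (G : Graph α β) :
    ∃ f : E(G) → Sym2 V(G), ∀ (e : E(G)) (x y : V(G)), G.IsLink e x y ↔ f e = s(x, y) := by
  have : ∀ e : E(G), ∃ p : Sym2 V(G), ∀ x y : V(G), G.IsLink e x y ↔ p = s(x, y) := fun e => by
    obtain ⟨x, y, h⟩ := G.exists_isLink_of_mem_edgeSet e.2
    refine ⟨s(⟨x, h.left_mem⟩, ⟨y, h.right_mem⟩), fun z w => ?_⟩
    rw [h.isLink_iff, Sym2.eq_iff]
    simp only [Subtype.ext_iff]
  choose f hf using this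
  exact ⟨f, hf⟩

/-- A bijection of vertices that preserves edge multiplicities extends to an isomorphism. -/
theorem isIsomorphic_of_edgeMult_eq {G : Graph α β} {H : Graph α' β'} [Finite E(G)] [Finite E(H)]
    (φ : V(G) ≃ V(H)) (h : ∀ x y : V(G), G.edgeMult x y = H.edgeMult (φ x) (φ y)) :
    G.IsIsomorphic H := by
  obtain ⟨f, hf⟩ := G.exists_ends
  obtain ⟨g, hg⟩ := H.exists_ends
  have hinj := Sym2.map.injective φ.injective
  have hfib : ∀ c : Sym2 V(H), Nonempty ({e // Sym2.map φ (f e) = c} ≃ {e // g e = c}) := by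
    intro c
    induction c with | _ x y
    obtain ⟨x, rfl⟩ := φ.surjective x
    obtain ⟨y, rfl⟩ := φ.surjective y
    have hxy := h x y
    rw [edgeMult_eq_card, edgeMult_eq_card] at hxy
    refine (Nonempty.map (fun e => ?_) (Finite.card_eq.1 hxy))
    refine ((Equiv.subtypeEquivRight fun e => ?_).trans e).trans
      (Equiv.subtypeEquivRight fun e => ?_)
    · rw [hf, ← Sym2.map_mk, hinj.eq_iff]
    · rw [hg]
  refine ⟨φ, Equiv.ofFiberEquiv fun c => (hfib c).some, fun e x y => ?_⟩
  rw [hf, hg, Equiv.ofFiberEquiv_map (fun c => (hfib c).some) e, ← Sym2.map_mk, hinj.eq_iff]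

theorem IsIsomorphic.isUniform {G : Graph α β} {H : Graph α' β'} (h : G.IsIsomorphic H) {n m : ℕ}
    (hH : H.IsUniform n m) : G.IsUniform n m := by
  obtain ⟨φ, ψ, h⟩ := h
  have hmult : ∀ x y : V(G), G.edgeMult x y = H.edgeMult (φ x) (φ y) := fun x y => by
    rw [edgeMult_eq_card, edgeMult_eq_card]
    exact Nat.card_congr (ψ.subtypeEquiv fun e => h e x y)
  refine ⟨by rw [Nat.card_congr φ, hH.1], fun x hx y hy => ?_⟩
  have := hH.2 (φ ⟨x, hx⟩) (φ _).2 (φ ⟨y, hy⟩) (φ _).2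
  rw [← hmult] at this
  simpa [← Subtype.ext_iff] using this

theorem IsUniform.isIsomorphic {G : Graph α β} {H : Graph α' β'} [Finite V(G)]
    [Finite V(H)] [Finite E(G)] [Finite E(H)] {n m : ℕ} (hG : G.IsUniform n m)
    (hH : H.IsUniform n m) : G.IsIsomorphic H := by
  obtain ⟨φ⟩ := Finite.card_eq.1 (hG.1.trans hH.1.symm)
  refine isIsomorphic_of_edgeMult_eq φ fun x y => ?_
  have h1 := hG.2 x x.2 y y.2
  have h2 := hH.2 (φ x) (φ x).2 (φ y) (φ y).2
  by_cases hxy : x = y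
  · subst hxy
    rw [h1.1 rfl, h2.1 rfl]
  · rw [h1.2 fun h => hxy (Subtype.ext h), h2.2 fun h => hxy (φ.injective (Subtype.ext h))]

theorem edgeMult_eq_zero_of_forall {G : Graph α β} {x y : α} (h : ∀ e, ¬ G.IsLink e x y) :
    G.edgeMult x y = 0 := by
  have : {e | G.IsLink e x y} = ∅ := Set.eq_empty_iff_forall_notMem.2 h
  rw [edgeMult, this, Set.ncard_empty]

theorem isUniform_banana {u v : α} (huv : u ≠ v) (F : Set β) :
    (banana u v F).IsUniform 2 F.ncard := by
  refine ⟨Set.ncard_pair huv, fun x hx y hy => ⟨?_, fun hxy => congrArg Set.ncard ?_⟩⟩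
  · rintro rfl
    refine edgeMult_eq_zero_of_forall fun e he => ?_
    grind
  · ext e
    rw [Set.mem_ofPred_eq]
    grind

theorem isUniform_cycle_two : (cycle 2).IsUniform 2 2 := by
  refine ⟨by simp [cycle], fun x _ y _ => ⟨?_, fun hxy => ?_⟩⟩
  · rintro rfl
    have : ∀ x e : Fin 2, ¬ ((x = e ∧ x = e + 1) ∨ (x = e + 1 ∧ x = e)) := by decide
    exact edgeMult_eq_zero_of_forall (this x)
  · have : ∀ x y : Fin 2, x ≠ y → ∀ e, (x = e ∧ y = e + 1) ∨ (x = e + 1 ∧ y = e) := by decide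
    have huniv : {e | (cycle 2).IsLink e x y} = Set.univ :=
      Set.eq_univ_iff_forall.2 (this x y hxy)
    rw [edgeMult, huniv, Set.ncard_univ, Nat.card_fin]

theorem isUniform_cycle_three : (cycle 3).IsUniform 3 1 := by
  refine ⟨by simp [cycle], fun x _ y _ => ⟨?_, fun hxy => ?_⟩⟩
  · rintro rfl
    have : ∀ x e : Fin 3, ¬ ((x = e ∧ x = e + 1) ∨ (x = e + 1 ∧ x = e)) := by decide
    exact edgeMult_eq_zero_of_forall (this x)
  · have : ∀ x y : Fin 3, x ≠ y →
        ∃ e, ∀ e', (x = e' ∧ y = e' + 1) ∨ (x = e' + 1 ∧ y = e') ↔ e' = e := by decide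
    obtain ⟨e, he⟩ := this x y hxy
    exact Set.ncard_eq_one.2 ⟨e, Set.ext he⟩

/-- The triangle on `0, 1, 2`, the edge between `x` and `y` being `x + y - 1`. -/
def natTriangle : Graph ℕ ℕ where
  vertexSet := Set.Iio 3
  IsLink e x y := x < 3 ∧ y < 3 ∧ x ≠ y ∧ x + y = e + 1
  isLink_symm := fun e _ => ⟨fun x y h => by omega⟩
  eq_or_eq_of_isLink_of_isLink := fun e x y v w h h' => by omega
  left_mem_of_isLink := fun e x y h => h.1

theorem isUniform_natTriangle : natTriangle.IsUniform 3 1 := by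
  refine ⟨?_, fun x hx y hy => ⟨?_, fun hxy => Set.ncard_eq_one.2 ⟨x + y - 1, Set.ext fun e => ?_⟩⟩⟩
  · change (Set.Iio 3).ncard = 3
    simp [Set.ncard_eq_toFinset_card']
  · rintro rfl
    exact edgeMult_eq_zero_of_forall fun e he => he.2.2.1 rfl
  · change x < 3 at hx
    change y < 3 at hy
    change (x < 3 ∧ y < 3 ∧ x ≠ y ∧ x + y = e + 1) ↔ e = x + y - 1
    omega

instance : Finite V(natTriangle) := inferInstanceAs (Finite (Set.Iio 3))

instance : Finite E(natTriangle) := by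
  refine ((Set.finite_Iio 5).subset ?_).to_subtype
  rintro e ⟨x, y, h⟩
  change e < 5
  change x < 3 ∧ y < 3 ∧ x ≠ y ∧ x + y = e + 1 at h
  omega

theorem isUniform_noEdge (x : α) : (noEdge {x} β).IsUniform 1 0 := by
  refine ⟨by simp, fun y _ z _ => ?_⟩
  simp [edgeMult]

/-! ### Exponents of Jacobians -/

theorem isUniform_of_exponent_dvd {G : Graph α β} [Fintype V(G)] [Finite E(G)] (hl : G.Loopless)
    (hb : G.IsBiconnected) {k : ℕ} (hk0 : 0 < k) (hk3 : k ≤ 3)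
    (hk : AddMonoid.exponent G.Jac ∣ k) :
    G.IsUniform 1 0 ∨ (∃ m, 0 < m ∧ m ≤ k ∧ G.IsUniform 2 m) ∨ (k = 3 ∧ G.IsUniform 3 1) := by
  have : Nonempty V(G) := hb.1.nonempty
  have h := ((exponent_jac_dvd_iff G k).1 hk).classification G.multMatrix_nonneg G.multMatrix_comm
    (supportConnected_multMatrix hb.1.preconnected) (supportBiconnected_multMatrix hb.2)
    (by omega) (by omega)
  rcases h with h | ⟨m, hm0, hmk, h⟩ | ⟨h3, h⟩
  · exact Or.inl (isUniform_of_isUniformMatrix hl h)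
  · lift m to ℕ using hm0.le
    exact Or.inr (Or.inl ⟨m, by omega, by omega, isUniform_of_isUniformMatrix hl h⟩)
  · exact Or.inr (Or.inr ⟨by omega, isUniform_of_isUniformMatrix hl h⟩)

/-- This excludes the default value 0 of `AddMonoid.exponent`, which would satisfy any upper bound.
-/
theorem exponent_jac_pos {G : Graph α β} [Fintype V(G)] [Finite E(G)]
    (hc : G.toSimpleGraph.Connected) : 0 < AddMonoid.exponent G.Jac := by
  have : Nonempty V(G) := hc.nonempty
  obtain ⟨k, hk0, hk⟩ := exists_laplacianKilledBy G.multMatrix_nonneg G.multMatrix_comm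
    (supportConnected_multMatrix hc.preconnected)
  exact Nat.pos_of_dvd_of_pos ((exponent_jac_dvd_iff G k).2 hk) hk0

theorem IsUniform.eq_of_two {G : Graph α β} [Finite V(G)] {n m n' m' : ℕ} (h : G.IsUniform n m)
    (h' : G.IsUniform n' m') (hn : 2 ≤ n) : n = n' ∧ m = m' := by
  have : Fintype V(G) := Fintype.ofFinite _
  obtain ⟨x, y, hxy⟩ := Fintype.one_lt_card_iff.1
    (show 1 < Fintype.card V(G) by rw [← Nat.card_eq_fintype_card, h.1]; omega)
  have hne : x.1 ≠ y.1 := fun h => hxy (Subtype.ext h)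
  exact ⟨h.1.symm.trans h'.1,
    ((h.2 x x.2 y y.2).2 hne).symm.trans ((h'.2 x x.2 y y.2).2 hne)⟩

/-- Only exponent 1 must be excluded. The classification for $k=1$ leaves $(n,m)=(1,0)$ and $(2,1)$,
both ruled out by $n+m>3$. -/
theorem IsUniform.exponent_eq_of_prime {G : Graph α β} [Fintype V(G)] [Finite E(G)] {n m p : ℕ}
    (h : G.IsUniform n m) (hn : 2 ≤ n) (hm : 0 < m) (hnm : 3 < n + m) (hp : p.Prime)
    (hk : AddMonoid.exponent G.Jac ∣ p) : AddMonoid.exponent G.Jac = p := by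
  refine ((Nat.dvd_prime hp).1 hk).resolve_left fun h1 => ?_
  rcases isUniform_of_exponent_dvd h.loopless (h.isBiconnected (by omega) hm.ne') one_pos
    (by omega) h1.dvd with h' | ⟨m', hm0, hm1, h'⟩ | ⟨h3, -⟩
  · have := h.eq_of_two h' hn
    omega
  · have := h.eq_of_two h' hn
    omega
  · omega

theorem IsUniform.exponent_jac_one_zero {G : Graph α β} [Fintype V(G)] (h : G.IsUniform 1 0) :
    AddMonoid.exponent G.Jac = 1 := by
  obtain ⟨x, hx⟩ := Fintype.card_eq_one_iff.1 (Nat.card_eq_fintype_card.symm.trans h.1)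
  have huniv : (Finset.univ : Finset V(G)) = {x} := by ext y; simp [hx y]
  refine Nat.dvd_one.1 ((exponent_jac_dvd_iff G 1).2 fun D hD => ⟨0, fun v => ?_⟩)
  rw [huniv, Finset.sum_singleton] at hD
  simp [hx v, hD, weightedLaplacian]

theorem IsUniform.exponent_jac_two_dvd {G : Graph α β} [Fintype V(G)] {m : ℕ}
    (h : G.IsUniform 2 m) : AddMonoid.exponent G.Jac ∣ m :=
  (exponent_jac_dvd_iff G m).2 h.isUniformMatrix.killedBy_two

theorem IsUniform.exponent_jac_dvd {G : Graph α β} [Fintype V(G)] {n m : ℕ}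
    (h : G.IsUniform n m) : AddMonoid.exponent G.Jac ∣ m * n := by
  rw [exponent_jac_dvd_iff]
  exact_mod_cast h.isUniformMatrix.killedBy

theorem biconnected_exponent_eq_two_iff (G : Graph α β) [Fintype V(G)] [Finite E(G)] :
    (G.Loopless ∧ G.IsBiconnected ∧ AddMonoid.exponent G.Jac = 2) ↔ G.IsUniform 2 2 := by
  constructor
  · rintro ⟨hl, hb, hk⟩
    rcases isUniform_of_exponent_dvd hl hb two_pos (by omega) hk.dvd with
      h | ⟨m, hm0, hm2, h⟩ | ⟨h3, -⟩
    · have := h.exponent_jac_one_zero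
      omega
    -- The exponent divides `m`, which complements the upper bound on `m` from the classification.
    · have := Nat.le_of_dvd hm0 h.exponent_jac_two_dvd
      obtain rfl : m = 2 := by omega
      exact h
    · omega
  · exact fun h => ⟨h.loopless, h.isBiconnected (by omega) (by omega),
      h.exponent_eq_of_prime le_rfl (by omega) (by omega) Nat.prime_two h.exponent_jac_two_dvd⟩

theorem biconnected_exponent_eq_three_iff (G : Graph α β) [Fintype V(G)] [Finite E(G)] :
    (G.Loopless ∧ G.IsBiconnected ∧ AddMonoid.exponent G.Jac = 3) ↔
      (G.IsUniform 2 3 ∨ G.IsUniform 3 1) := by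
  constructor
  · rintro ⟨hl, hb, hk⟩
    rcases isUniform_of_exponent_dvd hl hb three_pos le_rfl hk.dvd with
      h | ⟨m, hm0, hm3, h⟩ | ⟨-, h⟩
    · have := h.exponent_jac_one_zero
      omega
    · have := Nat.le_of_dvd hm0 h.exponent_jac_two_dvd
      obtain rfl : m = 3 := by omega
      exact Or.inl h
    · exact Or.inr h
  · rintro (h | h)
    · exact ⟨h.loopless, h.isBiconnected (by omega) (by omega),
        h.exponent_eq_of_prime le_rfl (by omega) (by omega) Nat.prime_three h.exponent_jac_two_dvd⟩
    · exact ⟨h.loopless, h.isBiconnected (by omega) (by omega),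
        h.exponent_eq_of_prime (by omega) (by omega) (by omega) Nat.prime_three h.exponent_jac_dvd⟩

/-- One list serves both bounds; its members are realised on ℕ so that they share a type. -/
theorem exists_isIsomorphic_of_exponent_le_three (G : Graph α β) [Fintype V(G)] [Finite E(G)]
    (hl : G.Loopless) (hb : G.IsBiconnected) (hk : AddMonoid.exponent G.Jac ≤ 3) :
    ∃ H ∈ insert (noEdge {0} ℕ) (insert natTriangle
      ((fun m : ℕ => banana 0 1 (Set.Iio m)) '' Set.Iic 3)), G.IsIsomorphic H := by
  rcases isUniform_of_exponent_dvd hl hb (exponent_jac_pos hb.1) hk dvd_rfl with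
    h | ⟨m, -, hmk, h⟩ | ⟨-, h⟩
  · have : Finite V(noEdge {0} ℕ) := inferInstanceAs (Finite ({0} : Set ℕ))
    have : Finite E(noEdge {0} ℕ) := inferInstanceAs (Finite (∅ : Set ℕ))
    exact ⟨_, Or.inl rfl, h.isIsomorphic (isUniform_noEdge (0 : ℕ))⟩
  · have : Finite V(banana 0 1 (Set.Iio m)) := inferInstanceAs (Finite ({0, 1} : Set ℕ))
    have : Finite E(banana 0 1 (Set.Iio m)) := inferInstanceAs (Finite (Set.Iio m))
    have hu := isUniform_banana (zero_ne_one (α := ℕ)) (Set.Iio m)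
    rw [show (Set.Iio m).ncard = m by simp [Set.ncard_eq_toFinset_card']] at hu
    exact ⟨_, Or.inr (Or.inr ⟨m, hmk.trans hk, rfl⟩), h.isIsomorphic hu⟩
  · exact ⟨_, Or.inr (Or.inl rfl), h.isIsomorphic isUniform_natTriangle⟩

theorem isIsomorphic_cycle_two_iff {G : Graph α β} [Finite V(G)] [Finite E(G)] :
    G.IsIsomorphic (cycle 2) ↔ G.IsUniform 2 2 :=
  ⟨fun h => h.isUniform isUniform_cycle_two, fun h => h.isIsomorphic isUniform_cycle_two⟩

theorem isIsomorphic_cycle_three_iff {G : Graph α β} [Finite V(G)] [Finite E(G)] :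
    G.IsIsomorphic (cycle 3) ↔ G.IsUniform 3 1 :=
  ⟨fun h => h.isUniform isUniform_cycle_three, fun h => h.isIsomorphic isUniform_cycle_three⟩

theorem isIsomorphic_bananaGraph_iff {G : Graph α β} [Finite V(G)] [Finite E(G)] (m : ℕ) :
    G.IsIsomorphic (bananaGraph m) ↔ G.IsUniform 2 m := by
  have hu : (bananaGraph m).IsUniform 2 m := by
    have := isUniform_banana (zero_ne_one (α := Fin 2)) (Set.univ : Set (Fin m))
    rwa [Set.ncard_univ, Nat.card_fin] at this
  exact ⟨fun h => h.isUniform hu, fun h => h.isIsomorphic hu⟩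

end Graph

theorem mainTheorem2 :
    (∀ k : ℕ, k = 2 ∨ k = 3 →
      ∃ S : Set (Graph ℕ ℕ), S.Finite ∧
        ∀ {α β : Type*} (G : Graph α β) [Fintype V(G)] [Finite E(G)],
          G.Loopless → G.IsBiconnected → AddMonoid.exponent G.Jac ≤ k →
            ∃ H ∈ S, G.IsIsomorphic H) ∧
    (∀ {α β : Type*} (G : Graph α β) [Fintype V(G)] [Finite E(G)],
      (G.Loopless ∧ G.IsBiconnected ∧ AddMonoid.exponent G.Jac = 2) ↔
        G.IsIsomorphic (Graph.cycle 2)) ∧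
    (∀ {α β : Type*} (G : Graph α β) [Fintype V(G)] [Finite E(G)],
      (G.Loopless ∧ G.IsBiconnected ∧ AddMonoid.exponent G.Jac = 3) ↔
        (G.IsIsomorphic (Graph.bananaGraph 3) ∨ G.IsIsomorphic (Graph.cycle 3))) := by
  refine ⟨fun k hk => ⟨_, (((Set.finite_Iic 3).image _).insert _).insert _,
    fun G _ _ hl hb hG =>
      Graph.exists_isIsomorphic_of_exponent_le_three G hl hb (by omega)⟩, fun G _ _ => ?_,
    fun G _ _ => ?_⟩
  · rw [Graph.isIsomorphic_cycle_two_iff, Graph.biconnected_exponent_eq_two_iff]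
  · rw [Graph.isIsomorphic_bananaGraph_iff, Graph.isIsomorphic_cycle_three_iff,
      Graph.biconnected_exponent_eq_three_iff]
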